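/- An equivalence structure is a pair $\mathcal A=(A,E)$ in which $A\subseteq\mathbb N$ is a computable set and $E$ is an equivalence relation on $A$; it is computable if $E$ is decidable. An embedding $\mathcal A\hookrightarrow\mathcal B$ is an injective map $\nu:A\to B$ with $x\,E^{\mathcal A}\,y\iff\nu(x)\,E^{\mathcal B}\,\nu(y)$ for all $x,y\in A$. Two structures are bi-embeddable if each embeds into the other. Let $\mathbf 0'$ be the Turing degree of the halting problem. A computable equivalence structure $\mathcal A$ is $\Delta^0_2$ bi-embeddably categorical if, for every computable equivalence structure $\mathcal B$ that is bi-embeddable with $\mathcal A$, there are $\mathbf 0'$-computable embeddings $\mathcal A\hookrightarrow\mathcal B$ and $\mathcal B\hookrightarrow\mathcal A$. A set of natural numbers is $\mathbf 0'$-immune if it is infinite and contains no infinite set that is computably enumerable in $\mathbf 0'$. (1) A computable equivalence structure is $\Delta^0_2$ bi-embeddably categorical if and only if it has only finitely many infinite equivalence classes. In particular, a computable equivalence structure with infinitely many infinite equivalence classes is not $\Delta^0_2$ bi-embeddably categorical. (2) There is a computable equivalence structure $\mathcal B$ with infinitely many infinite equivalence classes such that every set containing exactly one element of each infinite equivalence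 class of $\mathcal B$, and no other elements, is $\mathbf 0'$-immune, and such that every computable equivalence structure $\mathcal A$ with infinitely many infinite and no finite equivalence classes is bi-embeddable with $\mathcal B$, but there is no $\mathbf 0'$-computable embedding of $\mathcal A$ into $\mathcal B$. -/

import Mathlib

open scoped Computability

noncomputable section

/-- An equivalence structure: a computable set `univ` of natural numbers together with an
equivalence relation `E` on it. The relation is recorded as a relation on `ℕ` that only holds
between elements of `univ`. -/
structure EquivStructure where
  univ : Set ℕ
  E : ℕ → ℕ → Prop
  computable_univ : ComputablePred fun n : ℕ => n ∈ univ
  mem_of_rel : ∀ x y, E x y → x ∈ univ ∧ y ∈ univ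
  refl : ∀ x ∈ univ, E x x
  symm : ∀ x y, E x y → E y x
  trans : ∀ x y z, E x y → E y z → E x z

namespace EquivStructure

/-- The structure is computable: its atomic diagram, that is, its relation (the universe being
computable anyway), is decidable. -/
def IsComputable (A : EquivStructure) : Prop :=
  ComputablePred fun p : ℕ × ℕ => A.E p.1 p.2

/-- The equivalence class of `a`. -/
def eqClass (A : EquivStructure) (a : ℕ) : Set ℕ := {x | A.E a x}

/-- The set of all infinite equivalence classes. -/
def infiniteClasses (A : EquivStructure) : Set (Set ℕ) :=
  {c | (∃ a ∈ A.univ, c = A.eqClass a) ∧ c.Infinite}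

/-- The set of all finite equivalence classes. -/
def finiteClasses (A : EquivStructure) : Set (Set ℕ) :=
  {c | (∃ a ∈ A.univ, c = A.eqClass a) ∧ c.Finite}

/-- The elements whose equivalence class is infinite. -/
def infPart (A : EquivStructure) : Set ℕ := {a | a ∈ A.univ ∧ (A.eqClass a).Infinite}

/-- `T` is a transversal of the set `S` (a union of equivalence classes): a subset of `S`
that contains exactly one element of each equivalence class in `S`. -/
def IsTransversalOf (A : EquivStructure) (S T : Set ℕ) : Prop :=
  T ⊆ S ∧ (∀ x ∈ T, ∀ y ∈ T, A.E x y → x = y) ∧ ∀ a ∈ S, ∃ x ∈ T, A.E x a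

/-- Embeddings of structures: injective maps of the universes that preserve and reflect the
relation. -/
structure Embedding (A B : EquivStructure) where
  toFun : A.univ → B.univ
  injective : Function.Injective toFun
  rel_iff : ∀ x y : A.univ, A.E x y ↔ B.E (toFun x) (toFun y)

/-- An embedding seen as a partial function on `ℕ`, with domain the universe of `A`. -/
def Embedding.toPFun {A B : EquivStructure} (f : Embedding A B) : ℕ →. ℕ :=
  fun n => ⟨n ∈ A.univ, fun h => (f.toFun ⟨n, h⟩ : ℕ)⟩

/-- The embedding is computable in the oracle `g`. -/
def Embedding.ComputableFrom {A B : EquivStructure} (f : Embedding A B) (g : ℕ → ℕ) : Prop :=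
  f.toPFun ≤ᵀ (g : ℕ →. ℕ)

/-- Each of the two structures embeds into the other. -/
def BiEmbeddable (A B : EquivStructure) : Prop :=
  Nonempty (Embedding A B) ∧ Nonempty (Embedding B A)

/-- `A` is `d`-computably bi-embeddably categorical, where `d` is the Turing degree of `g`:
`A` is computable, and each computable structure that is bi-embeddable with `A` is
bi-embeddable with `A` by `d`-computable embeddings. -/
def BiEmbCategoricalIn (g : ℕ → ℕ) (A : EquivStructure) : Prop :=
  A.IsComputable ∧
    ∀ B : EquivStructure, B.IsComputable → BiEmbeddable A B →
      (∃ f : Embedding A B, f.ComputableFrom g) ∧ ∃ f : Embedding B A, f.ComputableFrom g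

end EquivStructure

open Classical in
/-- The characteristic function of the halting set: the Turing jump of the empty set. -/
def zeroJump (e : ℕ) : ℕ :=
  if ((Denumerable.ofNat Nat.Partrec.Code e).eval e).Dom then 1 else 0

/-- `A` is `Δ⁰₂` bi-embeddably categorical. -/
def EquivStructure.Delta02BiEmbCategorical (A : EquivStructure) : Prop :=
  A.BiEmbCategoricalIn zeroJump

/-- `W` is computably enumerable in `g`: the domain of a partial function computable in `g`. -/
def CEIn (g : ℕ → ℕ) (W : Set ℕ) : Prop :=
  ∃ f : ℕ →. ℕ, f ≤ᵀ (g : ℕ →. ℕ) ∧ W = f.Dom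

/-- `S` is immune relative to `g`: infinite, without an infinite subset that is computably
enumerable in `g`. -/
def ImmuneIn (g : ℕ → ℕ) (S : Set ℕ) : Prop :=
  S.Infinite ∧ ∀ W ⊆ S, W.Infinite → ¬ CEIn g W

end

/-! Σ₂ predicates stand in for enumerability in `0'`. There are two bridges: partial functions
computable in the halting problem have Σ₂ graphs (`Nat.RecursiveIn.sigmaTwo_graph`), and limits of
computable approximations are computable in it (`turingReducible_zeroJump_of_limit`).

Negative side: Post's simple set relative to `0'` is Σ₂ and coinfinite and meets every infinite Σ₂
set. Let B be a computable structure whose infinite classes are exactly those with index outside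
this set (`exists_infinite_iff_notMem`). A Σ₂ set of pairwise inequivalent elements of infinite
classes of B projects injectively onto a Σ₂ set of indices that misses the simple set, so it is
finite. Hence transversals are immune. Moreover, a `0'`-computable embedding into B of a computable
structure with infinitely many classes, all infinite, would map the least representatives onto an
infinite set of that kind. If A has infinitely many infinite classes, it is bi-embeddable with
`omegaOmega` and with B, and categoricity would give `0'`-computable embeddings `omegaOmega` → A →
B, whose composite cannot exist.

Positive side: let A embed into C, where C has finitely many infinite classes. Then all but finitely
many classes of A are finite and fit into infinitely many classes of C (`Embedding.finite_large`).
The exceptions are handled by a finite table. The others are placed greedily, and the choices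
converge because the size of a finite class is the limit of increasing counts. -/

noncomputable section

/-! ### Closure properties of computable predicates. -/

namespace ComputablePred

variable {α β : Type*} [Primcodable α] [Primcodable β]

theorem comp {p : β → Prop} {f : α → β} (hp : ComputablePred p) (hf : Computable f) :
    ComputablePred fun x => p (f x) := by
  obtain ⟨d, hd⟩ := hp
  exact ⟨fun x => d (f x), hd.comp hf⟩

theorem and {p q : α → Prop} (hp : ComputablePred p) (hq : ComputablePred q) :
    ComputablePred fun x => p x ∧ q x := by
  classical
  exact ⟨inferInstance, (Primrec.and.to_comp.comp hp.decide hq.decide).of_eq fun x => by simp⟩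

theorem or {p q : α → Prop} (hp : ComputablePred p) (hq : ComputablePred q) :
    ComputablePred fun x => p x ∨ q x := by
  classical
  exact ⟨inferInstance, (Primrec.or.to_comp.comp hp.decide hq.decide).of_eq fun x => by simp⟩

theorem imp {p q : α → Prop} (hp : ComputablePred p) (hq : ComputablePred q) :
    ComputablePred fun x => p x → q x :=
  (hp.not.or hq).of_eq fun _ => imp_iff_not_or.symm

theorem eq {f g : α → β} [DecidableEq β] (hf : Computable f) (hg : Computable g) :
    ComputablePred fun x => f x = g x :=
  ⟨inferInstance, (Primrec.beq.to_comp.comp hf hg).of_eq fun _ => rfl⟩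

theorem lt {f g : α → ℕ} (hf : Computable f) (hg : Computable g) :
    ComputablePred fun x => f x < g x :=
  (Primrec.nat_lt.computablePred).comp (hf.pair hg)

theorem le {f g : α → ℕ} (hf : Computable f) (hg : Computable g) :
    ComputablePred fun x => f x ≤ g x :=
  (Primrec.nat_le.computablePred).comp (hf.pair hg)

theorem ite' {c : α → Prop} [DecidablePred c] {f g : α → β} (hc : ComputablePred c)
    (hf : Computable f) (hg : Computable g) : Computable fun x => if c x then f x else g x := by
  simpa [Bool.cond_decide] using hc.decide.cond hf hg

/-- Bounded universal quantification preserves computability. -/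
theorem ball_lt {p : α × ℕ → Prop} {f : α → ℕ} (hp : ComputablePred p) (hf : Computable f) :
    ComputablePred fun x => ∀ i < f x, p (x, i) := by
  classical
  have h : Computable fun x => (Nat.rec true (fun i b => b && decide (p (x, i))) (f x) : Bool) :=
    Computable.nat_rec hf (Computable.const true)
      (Primrec.and.to_comp.comp (Computable.snd.comp Computable.snd)
        (hp.decide.comp (Computable.fst.pair (Computable.fst.comp Computable.snd)))).to₂
  have key : ∀ x n, (Nat.rec true (fun i b => b && decide (p (x, i))) n : Bool) = true ↔
      ∀ i < n, p (x, i) := fun x n => by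
    induction n with
    | zero => simp
    | succ n ih => exact .trans (by simp [ih]) Nat.forall_lt_succ_right.symm
  exact ⟨inferInstance, h.of_eq fun x => Bool.eq_iff_iff.2 <| (key x (f x)).trans (by simp)⟩

theorem bex_lt {p : α × ℕ → Prop} {f : α → ℕ} (hp : ComputablePred p) (hf : Computable f) :
    ComputablePred fun x => ∃ i < f x, p (x, i) :=
  (hp.not.ball_lt hf).not.of_eq fun x => by simp

end ComputablePred

/-! ### Σ₂ predicates and their closure properties. -/

/-- A predicate of the form `∃ a, ∀ b, R x a b` with `R` computable. -/
def SigmaTwo {α : Type*} [Primcodable α] (p : α → Prop) : Prop :=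
  ∃ R : α × ℕ × ℕ → Prop, ComputablePred R ∧ ∀ x, p x ↔ ∃ a, ∀ b, R (x, a, b)

namespace SigmaTwo

variable {α β : Type*} [Primcodable α] [Primcodable β]

theorem of_eq {p q : α → Prop} (hp : SigmaTwo p) (h : ∀ x, p x ↔ q x) : SigmaTwo q :=
  (funext fun x => propext (h x) : p = q) ▸ hp

theorem of_computablePred {p : α → Prop} (hp : ComputablePred p) : SigmaTwo p :=
  ⟨fun x => p x.1, hp.comp Computable.fst, by simp⟩

theorem exists_nat {p : α × ℕ → Prop} (hp : ComputablePred p) : SigmaTwo fun x => ∃ n, p (x, n) :=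
  ⟨fun x => p (x.1, x.2.1),
    hp.comp (Computable.fst.pair (Computable.fst.comp Computable.snd)), by simp⟩

theorem forall_nat {p : α × ℕ → Prop} (hp : ComputablePred p) : SigmaTwo fun x => ∀ n, p (x, n) :=
  ⟨fun x => p (x.1, x.2.2),
    hp.comp (Computable.fst.pair (Computable.snd.comp Computable.snd)), by simp⟩

theorem comp {p : β → Prop} {f : α → β} (hp : SigmaTwo p) (hf : Computable f) :
    SigmaTwo fun x => p (f x) := by
  obtain ⟨R, hR, h⟩ := hp
  exact ⟨fun x => R (f x.1, x.2), hR.comp ((hf.comp Computable.fst).pair Computable.snd),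
    fun x => h (f x)⟩

theorem and {p q : α → Prop} (hp : SigmaTwo p) (hq : SigmaTwo q) :
    SigmaTwo fun x => p x ∧ q x := by
  obtain ⟨R, hR, h⟩ := hp
  obtain ⟨R', hR', h'⟩ := hq
  have hu : Computable fun x : α × ℕ × ℕ => x.2.1.unpair :=
    Computable.unpair.comp (Computable.fst.comp Computable.snd)
  have hb : Computable fun x : α × ℕ × ℕ => x.2.2 := Computable.snd.comp Computable.snd
  -- One outer witness codes a pair of witnesses; the universal variable is shared.
  refine ⟨fun x => R (x.1, x.2.1.unpair.1, x.2.2) ∧ R' (x.1, x.2.1.unpair.2, x.2.2),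
    (hR.comp (Computable.fst.pair ((Computable.fst.comp hu).pair hb))).and
      (hR'.comp (Computable.fst.pair ((Computable.snd.comp hu).pair hb))), fun x => ?_⟩
  refine (and_congr (h x) (h' x)).trans ?_
  constructor
  · rintro ⟨⟨a, ha⟩, c, hc⟩
    exact ⟨Nat.pair a c, fun b => by simpa using ⟨ha b, hc b⟩⟩
  · rintro ⟨a, ha⟩
    exact ⟨⟨a.unpair.1, fun b => (ha b).1⟩, a.unpair.2, fun b => (ha b).2⟩

theorem or {p q : α → Prop} (hp : SigmaTwo p) (hq : SigmaTwo q) :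
    SigmaTwo fun x => p x ∨ q x := by
  obtain ⟨R, hR, h⟩ := hp
  obtain ⟨R', hR', h'⟩ := hq
  have hu : Computable fun x : α × ℕ × ℕ => x.2.1.unpair :=
    Computable.unpair.comp (Computable.fst.comp Computable.snd)
  have hb : Computable fun x : α × ℕ × ℕ => x.2.2 := Computable.snd.comp Computable.snd
  have hc : ComputablePred fun x : α × ℕ × ℕ => x.2.1.unpair.1 = 0 :=
    .eq (Computable.fst.comp hu) (Computable.const 0)
  have hx : Computable fun x : α × ℕ × ℕ => (x.1, x.2.1.unpair.2, x.2.2) :=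
    Computable.fst.pair ((Computable.snd.comp hu).pair hb)
  -- The first component of the witness tells which disjunct is being witnessed.
  refine ⟨fun x => x.2.1.unpair.1 = 0 ∧ R (x.1, x.2.1.unpair.2, x.2.2) ∨
      ¬ x.2.1.unpair.1 = 0 ∧ R' (x.1, x.2.1.unpair.2, x.2.2),
    (hc.and (hR.comp hx)).or (hc.not.and (hR'.comp hx)), fun x => ?_⟩
  refine (or_congr (h x) (h' x)).trans ?_
  constructor
  · rintro (⟨a, ha⟩ | ⟨a, ha⟩)
    · exact ⟨Nat.pair 0 a, fun b => by simpa using ha b⟩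
    · exact ⟨Nat.pair 1 a, fun b => by simpa using ha b⟩
  · rintro ⟨a, ha⟩
    by_cases h0 : a.unpair.1 = 0
    · exact Or.inl ⟨_, fun b => by simpa [h0] using ha b⟩
    · exact Or.inr ⟨_, fun b => by simpa [h0] using ha b⟩

/-- A general `Denumerable` type lets programs and finite sequences serve as witnesses, besides
numbers. -/
theorem ex {γ : Type*} [Denumerable γ] {p : α × γ → Prop} (hp : SigmaTwo p) :
    SigmaTwo fun x => ∃ y, p (x, y) := by
  obtain ⟨R, hR, h⟩ := hp
  have hu : Computable fun x : α × ℕ × ℕ => x.2.1.unpair :=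
    Computable.unpair.comp (Computable.fst.comp Computable.snd)
  refine ⟨fun x => R ((x.1, Denumerable.ofNat γ x.2.1.unpair.1), x.2.1.unpair.2, x.2.2),
    hR.comp ((Computable.fst.pair ((Computable.ofNat γ).comp (Computable.fst.comp hu))).pair
      ((Computable.snd.comp hu).pair (Computable.snd.comp Computable.snd))), fun x => ?_⟩
  constructor
  · rintro ⟨y, hy⟩
    obtain ⟨a, ha⟩ := (h _).1 hy
    exact ⟨Nat.pair (Encodable.encode y) a, fun b => by simpa using ha b⟩
  · rintro ⟨a, ha⟩
    exact ⟨Denumerable.ofNat γ a.unpair.1, (h _).2 ⟨a.unpair.2, ha⟩⟩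

theorem ball_lt {p : α × ℕ → Prop} {f : α → ℕ} (hp : SigmaTwo p) (hf : Computable f) :
    SigmaTwo fun x => ∀ i < f x, p (x, i) := by
  obtain ⟨R, hR, h⟩ := hp
  have hb : Computable fun x : α × ℕ × ℕ => x.2.2.unpair :=
    Computable.unpair.comp (Computable.snd.comp Computable.snd)
  have hl : Computable fun x : α × ℕ × ℕ =>
      ((Denumerable.ofNat (List ℕ) x.2.1)[x.2.2.unpair.1]?).getD 0 :=
    Computable.option_getD (Computable.list_getElem?.comp
      ((Computable.ofNat (List ℕ)).comp (Computable.fst.comp Computable.snd))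
      (Computable.fst.comp hb)) (Computable.const 0)
  -- Collection: a list gathers one witness for each `i < f x`, and the universal variable codes `i`
  -- together with the old one.
  refine ⟨fun x => x.2.2.unpair.1 < f x.1 → R ((x.1, x.2.2.unpair.1),
      ((Denumerable.ofNat (List ℕ) x.2.1)[x.2.2.unpair.1]?).getD 0, x.2.2.unpair.2),
    (ComputablePred.lt (Computable.fst.comp hb) (hf.comp Computable.fst)).imp
      (hR.comp ((Computable.fst.pair (Computable.fst.comp hb)).pair
        (hl.pair (Computable.snd.comp hb)))), fun x => ?_⟩
  constructor
  · intro H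
    have H' : ∀ i, ∃ a, i < f x → ∀ b, R ((x, i), a, b) := fun i => by
      by_cases hi : i < f x
      · obtain ⟨a, ha⟩ := (h _).1 (H i hi)
        exact ⟨a, fun _ => ha⟩
      · exact ⟨0, fun h => absurd h hi⟩
    choose g hg using H'
    refine ⟨Encodable.encode ((List.range (f x)).map g), fun b hb => ?_⟩
    simpa [hb] using hg _ hb b.unpair.2
  · rintro ⟨a, ha⟩ i hi
    exact (h _).2 ⟨_, fun b => by simpa using ha (Nat.pair i b) (by simpa using hi)⟩

/-- Every `Σ₂` set of numbers is of the form `{x | ∃ a, φ x a is undefined}` with `φ` partial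
recursive. -/
theorem exists_code {p : ℕ → Prop} (hp : SigmaTwo p) :
    ∃ c : Nat.Partrec.Code, ∀ x, p x ↔ ∃ a, ¬ (c.eval (Nat.pair x a)).Dom := by
  classical
  obtain ⟨R, hR, h⟩ := hp
  have hu : Computable fun x : ℕ × ℕ => x.1.unpair := Computable.unpair.comp Computable.fst
  -- The search for a counterexample `b` diverges exactly when `R` holds for all `b`.
  have hf : Partrec fun n : ℕ => Nat.rfind fun b =>
      Part.some (decide (¬ R (n.unpair.1, n.unpair.2, b))) :=
    Partrec.rfind (hR.not.comp ((Computable.fst.comp hu).pair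
      ((Computable.snd.comp hu).pair Computable.snd))).decide.partrec
  obtain ⟨c, hc⟩ := Nat.Partrec.Code.exists_code.1 (Partrec.nat_iff.1 hf)
  refine ⟨c, fun x => (h x).trans (exists_congr fun a => ?_)⟩
  rw [hc]
  refine .trans ?_ (not_congr Nat.rfind_dom).symm
  simp

end SigmaTwo

/-! ### Functions computable in the halting problem have Σ₂ graphs. -/

theorem computablePred_evaln_isSome : ComputablePred fun x : (ℕ × Nat.Partrec.Code) × ℕ =>
    (Nat.Partrec.Code.evaln x.1.1 x.1.2 x.2).isSome :=
  ⟨inferInstance, ((Primrec.option_isSome.comp Nat.Partrec.Code.primrec_evaln).to_comp).of_eq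
    fun x => by simp⟩

theorem Nat.Partrec.Code.eval_dom_iff (c : Nat.Partrec.Code) (n : ℕ) :
    (c.eval n).Dom ↔ ∃ k, (Nat.Partrec.Code.evaln k c n).isSome := by
  simp only [Part.dom_iff_mem, Nat.Partrec.Code.evaln_complete, Option.isSome_iff_exists]
  exact exists_comm

theorem SigmaTwo.eval_dom : SigmaTwo fun x : Nat.Partrec.Code × ℕ => (x.1.eval x.2).Dom :=
  (SigmaTwo.exists_nat (p := fun y : (Nat.Partrec.Code × ℕ) × ℕ =>
    (Nat.Partrec.Code.evaln y.2 y.1.1 y.1.2).isSome)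
    (computablePred_evaln_isSome.comp ((Computable.snd.pair
      (Computable.fst.comp Computable.fst)).pair (Computable.snd.comp Computable.fst)))).of_eq
    fun x => (Nat.Partrec.Code.eval_dom_iff x.1 x.2).symm

theorem SigmaTwo.not_eval_dom : SigmaTwo fun x : Nat.Partrec.Code × ℕ => ¬ (x.1.eval x.2).Dom :=
  (SigmaTwo.forall_nat (p := fun y : (Nat.Partrec.Code × ℕ) × ℕ =>
    ¬ (Nat.Partrec.Code.evaln y.2 y.1.1 y.1.2).isSome)
    (computablePred_evaln_isSome.comp ((Computable.snd.pair
      (Computable.fst.comp Computable.fst)).pair (Computable.snd.comp Computable.fst))).not).of_eq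
    fun x => by rw [Nat.Partrec.Code.eval_dom_iff, not_exists]

/-- The value 1 is a Σ₁ condition and the value 0 a Π₁ condition; both are Σ₂. -/
theorem sigmaTwo_zeroJump : SigmaTwo fun x : ℕ × ℕ => x.2 = zeroJump x.1 := by
  have hc : Computable fun x : ℕ × ℕ => (Denumerable.ofNat Nat.Partrec.Code x.1, x.1) :=
    ((Computable.ofNat _).comp Computable.fst).pair Computable.fst
  refine (((SigmaTwo.of_computablePred (.eq Computable.snd (Computable.const 1))).and
    (SigmaTwo.eval_dom.comp hc)).or ((SigmaTwo.of_computablePred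
      (.eq Computable.snd (Computable.const 0))).and (SigmaTwo.not_eval_dom.comp hc))).of_eq
      fun x => ?_
  unfold zeroJump
  split_ifs with h <;> simp [h]

/-- The graph of a partial function computable in the halting problem is `Σ₂`. -/
theorem Nat.RecursiveIn.sigmaTwo_graph {f : ℕ →. ℕ}
    (hf : Nat.RecursiveIn {(zeroJump : ℕ →. ℕ)} f) : SigmaTwo fun x : ℕ × ℕ => x.2 ∈ f x.1 := by
  have tot : ∀ {g : ℕ → ℕ}, Computable g → SigmaTwo fun x : ℕ × ℕ => x.2 ∈ (g : ℕ →. ℕ) x.1 :=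
    fun hg => (SigmaTwo.of_computablePred
      (.eq Computable.snd (hg.comp Computable.fst))).of_eq fun x => by simp
  have hu1 : Computable fun x : ℕ => x.unpair.1 := Computable.fst.comp Computable.unpair
  have hu2 : Computable fun x : ℕ => x.unpair.2 := Computable.snd.comp Computable.unpair
  have hp : ∀ {α : Type} [Primcodable α] {f g : α → ℕ}, Computable f → Computable g →
      Computable fun x => Nat.pair (f x) (g x) := fun hf hg => Primrec₂.natPair.to_comp.comp hf hg
  induction hf with
  | zero => exact tot (Computable.const 0)
  | succ => exact tot Computable.succ
  | left => exact tot hu1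
  | right => exact tot hu2
  | oracle g hg =>
    obtain rfl := hg
    exact sigmaTwo_zeroJump.of_eq fun x => by simp
  | @pair f h _ _ ihf ihh =>
    refine ((ihf.comp (Computable.fst.pair (hu1.comp Computable.snd))).and
      (ihh.comp (Computable.fst.pair (hu2.comp Computable.snd)))).of_eq fun x => ?_
    simp only [Seq.seq, Part.map_eq_map, Part.mem_bind_iff, Part.mem_map_iff]
    constructor
    · rintro ⟨h1, h2⟩
      exact ⟨_, ⟨_, h1, rfl⟩, _, h2, by simp⟩
    · rintro ⟨_, ⟨a, h1, rfl⟩, b, h2, h3⟩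
      rw [← h3]
      simpa using ⟨h1, h2⟩
  | @comp f h _ _ ihf ihh =>
    refine (SigmaTwo.ex (p := fun y : (ℕ × ℕ) × ℕ => y.2 ∈ h y.1.1 ∧ y.1.2 ∈ f y.2)
      ((ihh.comp ((Computable.fst.comp Computable.fst).pair Computable.snd)).and
      (ihf.comp (Computable.snd.pair (Computable.snd.comp Computable.fst))))).of_eq fun x => ?_
    exact (Part.mem_bind_iff (f := h x.1) (g := f) (b := x.2)).symm
  | @prec f h _ _ ihf ihh =>
    have hn : Computable fun y : (ℕ × ℕ) × List ℕ => y.1.1.unpair.2 :=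
      hu2.comp (Computable.fst.comp Computable.fst)
    have ha : Computable fun y : (ℕ × ℕ) × List ℕ => y.1.1.unpair.1 :=
      hu1.comp (Computable.fst.comp Computable.fst)
    have hget : ∀ {α : Type} [Primcodable α] {l : α → List ℕ} {i : α → ℕ},
        Computable l → Computable i → Computable fun x => ((l x)[i x]?).getD 0 :=
      fun hl hi => Computable.option_getD (Computable.list_getElem?.comp hl hi)
        (Computable.const 0)
    -- The witness is the list of all intermediate values of the recursion.
    refine (SigmaTwo.ex (p := fun y : (ℕ × ℕ) × List ℕ =>
      ((y.2[0]?).getD 0 ∈ f y.1.1.unpair.1 ∧ (y.2[y.1.1.unpair.2]?).getD 0 = y.1.2) ∧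
      ∀ i < y.1.1.unpair.2, (y.2[i + 1]?).getD 0 ∈
        h (Nat.pair y.1.1.unpair.1 (Nat.pair i ((y.2[i]?).getD 0))))
      (((ihf.comp (ha.pair (hget Computable.snd (Computable.const 0)))).and
        (.of_computablePred (.eq (hget Computable.snd hn)
          (Computable.snd.comp Computable.fst)))).and
        (SigmaTwo.ball_lt (p := fun z : ((ℕ × ℕ) × List ℕ) × ℕ => (z.1.2[z.2 + 1]?).getD 0 ∈
          h (Nat.pair z.1.1.1.unpair.1 (Nat.pair z.2 ((z.1.2[z.2]?).getD 0))))
          (ihh.comp ((hp (ha.comp Computable.fst) (hp Computable.snd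
            (hget (Computable.snd.comp Computable.fst) Computable.snd))).pair
            (hget (Computable.snd.comp Computable.fst)
              (Computable.succ.comp Computable.snd)))) hn))).of_eq fun x => ?_
    obtain ⟨x, y⟩ := x
    obtain ⟨⟨a, n⟩, rfl⟩ : ∃ q : ℕ × ℕ, Nat.pair q.1 q.2 = x := ⟨x.unpair, by simp⟩
    simp only [Nat.unpair_pair]
    clear hn ha
    constructor
    · rintro ⟨l, ⟨h0, rfl⟩, h2⟩
      induction n with
      | zero => exact h0
      | succ n ih =>
        exact Part.mem_bind (ih fun i hi => h2 i (by omega)) (h2 n (by omega))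
    · intro hy
      suffices H : ∃ l : List ℕ, l.length = n + 1 ∧ ((l[0]?).getD 0 ∈ f a ∧ (l[n]?).getD 0 = y) ∧
          ∀ i < n, (l[i + 1]?).getD 0 ∈ h (Nat.pair a (Nat.pair i ((l[i]?).getD 0))) by
        obtain ⟨l, -, hl⟩ := H
        exact ⟨l, hl⟩
      induction n generalizing y with
      | zero => exact ⟨[y], by simpa using hy⟩
      | succ n ih =>
        obtain ⟨u, hu, hy⟩ := Part.mem_bind_iff.1 hy
        obtain ⟨l, hl, ⟨h0, h1⟩, h2⟩ := ih u hu
        refine ⟨l ++ [y], by simp [hl], ⟨?_, ?_⟩, fun i hi => ?_⟩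
        · rwa [List.getElem?_append_left (by omega)]
        · simp [← hl]
        · rcases Nat.lt_succ_iff_lt_or_eq.1 hi with hi | rfl
          · rw [List.getElem?_append_left (by omega), List.getElem?_append_left (by omega)]
            exact h2 i hi
          · rw [List.getElem?_append_left (by omega), h1]
            simpa [← hl] using hy
  | @rfind f _ ih =>
    -- Before the zero, the function must converge to something nonzero. Asking for the value
    -- existentially keeps this Σ₂.
    have hx : SigmaTwo fun y : ((ℕ × ℕ) × ℕ) × ℕ =>
        y.2 ∈ f (Nat.pair y.1.1.1 y.1.2) ∧ ¬ y.2 = 0 :=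
      (ih.comp ((hp (Computable.fst.comp (Computable.fst.comp Computable.fst))
        (Computable.snd.comp Computable.fst)).pair Computable.snd)).and
        (.of_computablePred (ComputablePred.eq Computable.snd (Computable.const 0)).not)
    refine ((ih.comp ((hp Computable.fst Computable.snd).pair (Computable.const 0))).and
      (hx.ex.ball_lt Computable.snd)).of_eq fun x => ?_
    refine .trans ?_ Nat.mem_rfind.symm
    simp

theorem TuringReducible.sigmaTwo_graph {f : ℕ →. ℕ} (hf : f ≤ᵀ (zeroJump : ℕ →. ℕ)) :
    SigmaTwo fun x : ℕ × ℕ => x.2 ∈ f x.1 :=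
  (RecursiveIn.iff_nat.1 hf).sigmaTwo_graph

theorem CEIn.sigmaTwo {W : Set ℕ} (hW : CEIn zeroJump W) : SigmaTwo fun x => x ∈ W := by
  obtain ⟨f, hf, rfl⟩ := hW
  exact hf.sigmaTwo_graph.ex.of_eq fun x => (PFun.mem_dom f x).symm

/-! ### The limit lemma. -/

/-- The **limit lemma**, in the direction from computable approximations to computability in the
halting problem, for partial functions with computable domain. -/
theorem turingReducible_zeroJump_of_limit {s : ℕ → ℕ → ℕ} {U : Set ℕ} {v : (n : ℕ) → n ∈ U → ℕ}
    (hs : Computable₂ s) (hU : ComputablePred fun n => n ∈ U)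
    (hv : ∀ n (h : n ∈ U), ∀ᶠ t in Filter.atTop, s n t = v n h) :
    (fun n => ⟨n ∈ U, v n⟩ : ℕ →. ℕ) ≤ᵀ (zeroJump : ℕ →. ℕ) := by
  classical
  have hu1 : Computable fun x : ℕ × ℕ => x.1.unpair.1 :=
    Computable.fst.comp (Computable.unpair.comp Computable.fst)
  have hu2 : Computable fun x : ℕ × ℕ => x.1.unpair.2 :=
    Computable.snd.comp (Computable.unpair.comp Computable.fst)
  -- On the code of `(n, k)`, this searches for a stage after `k` at which the approximation at `n`
  -- differs from that at stage `k`.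
  have hchange : Partrec fun p : ℕ => Nat.rfind fun m => Part.some
      (decide (p.unpair.2 ≤ m ∧ ¬ s p.unpair.1 m = s p.unpair.1 p.unpair.2)) :=
    Partrec.rfind ((ComputablePred.le hu2 Computable.snd).and
      (ComputablePred.eq (hs.comp hu1 Computable.snd) (hs.comp hu1 hu2)).not).decide.partrec
  obtain ⟨c, hc⟩ := Nat.Partrec.Code.exists_code.1 (Partrec.nat_iff.1 hchange)
  -- The program `r p` ignores its input and runs `c` on `p`, so its halting on its own index is a
  -- question about `p` alone.
  let r : ℕ → ℕ := fun p => Encodable.encode (c.comp (Nat.Partrec.Code.const p))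
  have hr : Computable r := Computable.encode.comp
    (Nat.Partrec.Code.primrec₂_comp.to_comp.comp (Computable.const c)
      Nat.Partrec.Code.primrec_const.to_comp)
  have hr0 : ∀ n k, zeroJump (r (Nat.pair n k)) = 0 ↔ ∀ m, k ≤ m → s n m = s n k := by
    intro n k
    have : (Nat.Partrec.Code.eval (Denumerable.ofNat Nat.Partrec.Code (r (Nat.pair n k)))
        (r (Nat.pair n k))).Dom ↔ ∃ m, k ≤ m ∧ ¬ s n m = s n k := by
      simp only [r, Denumerable.ofNat_encode, Nat.Partrec.Code.eval, Nat.Partrec.Code.eval_const,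
        Part.bind_eq_bind, Part.bind_some, hc]
      refine Nat.rfind_dom.trans ?_
      simp
    unfold zeroJump
    rw [this]
    split_ifs with h
    · simpa using h
    · simpa using h
  have hG : Nat.RecursiveIn {(zeroJump : ℕ →. ℕ)} fun p => Part.some (zeroJump (r p)) :=
    (Nat.RecursiveIn.comp (.oracle _ (Set.mem_singleton _))
      (Partrec.nat_iff.1 hr.partrec).recursiveIn).of_eq fun p => Part.bind_some _ _
  -- The least stage from which the approximation no longer changes.
  have hK := Nat.RecursiveIn.rfind hG
  have hid : Nat.RecursiveIn {(zeroJump : ℕ →. ℕ)} fun n => Part.some n :=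
    Nat.Partrec.some.recursiveIn
  have hs' : Nat.Partrec fun p : ℕ => Part.some (s p.unpair.1 p.unpair.2) :=
    Partrec.nat_iff.1 (hs.comp (Computable.fst.comp Computable.unpair)
      (Computable.snd.comp Computable.unpair)).partrec
  have hlim := Nat.RecursiveIn.comp hs'.recursiveIn (hid.pair hK)
  -- Outside `U` the search might still succeed, so the domain is cut down explicitly.
  have hres : Partrec fun n : ℕ => if n ∈ U then Part.some n else Part.none :=
    (Partrec.cond hU.decide Computable.id.partrec Partrec.none).of_eq fun n => by
      by_cases h : n ∈ U <;> simp [h]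
  refine RecursiveIn.iff_nat.2 ((Nat.RecursiveIn.comp hlim
    (Partrec.nat_iff.1 hres).recursiveIn).of_eq fun n => ?_)
  by_cases hn : n ∈ U
  · obtain ⟨T, hT⟩ := Filter.eventually_atTop.1 (hv n hn)
    have hex : ∃ k, zeroJump (r (Nat.pair n k)) = 0 :=
      ⟨T, (hr0 n T).2 fun m hm => (hT m hm).trans (hT T le_rfl).symm⟩
    have hfind : Nat.find hex ∈ Nat.rfind fun k =>
        (fun m => decide (m = 0)) <$> Part.some (zeroJump (r (Nat.pair n k))) := by
      refine Nat.mem_rfind.2 ⟨by simp [Nat.find_spec hex], fun {m} hm => ?_⟩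
      simpa using Nat.find_min hex hm
    have hval : s n (Nat.find hex) = v n hn := by
      rw [← (hr0 n _).1 (Nat.find_spec hex) _ (le_max_left _ T), hT _ (le_max_right _ _)]
    have hrhs : (⟨n ∈ U, v n⟩ : Part ℕ) = Part.some (v n hn) :=
      Part.eq_some_iff.2 ⟨hn, rfl⟩
    simp only [hn, if_true, Part.bind_eq_bind, Part.bind_some]
    rw [Part.eq_some_iff.2 hfind]
    simp [Seq.seq, hval, hrhs]
  · rw [if_neg hn]
    refine (Part.eq_none_iff'.2 ?_).trans (Part.eq_none_iff'.2 hn).symm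
    simp

/-! ### Post's simple set relative to the halting problem. -/

/-- The pair `p` is the first one, among those whose left component exceeds twice the index of
`c`, at which the program `c` diverges. -/
def IsFirstDivergence (c : Nat.Partrec.Code) (p : ℕ) : Prop :=
  ¬ (c.eval p).Dom ∧ ∀ q < p, 2 * Encodable.encode c < q.unpair.1 → (c.eval q).Dom

/-- Post's simple set, relative to the halting problem. -/
def postSimpleSet : Set ℕ :=
  {n | ∃ c : Nat.Partrec.Code, ∃ a : ℕ, 2 * Encodable.encode c < n ∧
    IsFirstDivergence c (Nat.pair n a)}

/-- Divergence is Π₁ and halting at finitely many earlier pairs is Σ₂ by `SigmaTwo.ball_lt`. -/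
theorem sigmaTwo_postSimpleSet : SigmaTwo fun n => n ∈ postSimpleSet := by
  have hpair : Computable fun x : (ℕ × Nat.Partrec.Code) × ℕ => Nat.pair x.1.1 x.2 :=
    Primrec₂.natPair.to_comp.comp (Computable.fst.comp Computable.fst) Computable.snd
  have hc : Computable fun x : (ℕ × Nat.Partrec.Code) × ℕ => x.1.2 :=
    Computable.snd.comp Computable.fst
  have hd : Computable fun x : (ℕ × Nat.Partrec.Code) × ℕ => 2 * Encodable.encode x.1.2 :=
    Primrec.nat_mul.to_comp.comp (Computable.const 2) (Computable.encode.comp hc)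
  have hball : SigmaTwo fun x : (ℕ × Nat.Partrec.Code) × ℕ =>
      ∀ q < Nat.pair x.1.1 x.2, 2 * Encodable.encode x.1.2 < q.unpair.1 → (x.1.2.eval q).Dom := by
    refine SigmaTwo.ball_lt (p := fun y : ((ℕ × Nat.Partrec.Code) × ℕ) × ℕ =>
      2 * Encodable.encode y.1.1.2 < y.2.unpair.1 → (y.1.1.2.eval y.2).Dom) ?_ hpair
    exact ((SigmaTwo.of_computablePred (ComputablePred.lt (hd.comp Computable.fst)
      (Computable.fst.comp (Computable.unpair.comp Computable.snd))).not).or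
      (SigmaTwo.eval_dom.comp ((hc.comp Computable.fst).pair Computable.snd))).of_eq
      fun _ => imp_iff_not_or.symm
  exact (SigmaTwo.ex (SigmaTwo.ex (p := fun x : (ℕ × Nat.Partrec.Code) × ℕ =>
    2 * Encodable.encode x.1.2 < x.1.1 ∧ IsFirstDivergence x.1.2 (Nat.pair x.1.1 x.2))
    ((SigmaTwo.of_computablePred (.lt hd (Computable.fst.comp Computable.fst))).and
      ((SigmaTwo.not_eval_dom.comp (hc.pair hpair)).and hball)))).of_eq fun _ => Iff.rfl

/-- Membership in `W` is divergence of some program `c` at a pair. As `W` is infinite, `c` diverges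
beyond its threshold, and the first such pair puts its left component into both sets. -/
theorem postSimpleSet_inter_nonempty {W : Set ℕ} (hW : SigmaTwo fun n => n ∈ W)
    (hinf : W.Infinite) : (W ∩ postSimpleSet).Nonempty := by
  classical
  obtain ⟨c, hc⟩ := hW.exists_code
  have hex : ∃ p : ℕ, 2 * Encodable.encode c < p.unpair.1 ∧ ¬ (c.eval p).Dom := by
    obtain ⟨x, hx, hlt⟩ := hinf.exists_gt (2 * Encodable.encode c)
    obtain ⟨a, ha⟩ := (hc x).1 hx
    exact ⟨Nat.pair x a, by simpa using hlt, ha⟩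
  obtain ⟨h1, h2⟩ := Nat.find_spec hex
  refine ⟨(Nat.find hex).unpair.1, (hc _).2 ⟨(Nat.find hex).unpair.2, by simpa using h2⟩, c,
    (Nat.find hex).unpair.2, h1, ?_⟩
  rw [Nat.pair_unpair]
  exact ⟨h2, fun q hq hlt => by simpa [hlt] using Nat.find_min hex hq⟩

/-- Each program contributes at most one element, which exceeds twice its index. So at most `k` of
the `2 * k + 1` numbers up to `2 * k` are in the set, and the complement cannot have just `k`
elements. -/
theorem infinite_compl_postSimpleSet : postSimpleSetᶜ.Infinite := by
  classical
  intro hfin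
  have h : ∀ n, ∃ c : Nat.Partrec.Code, n ∈ postSimpleSet →
      ∃ a : ℕ, 2 * Encodable.encode c < n ∧ IsFirstDivergence c (Nat.pair n a) := fun n => by
    by_cases hn : n ∈ postSimpleSet
    · obtain ⟨c, hc⟩ := hn
      exact ⟨c, fun _ => hc⟩
    · exact ⟨.zero, fun h => absurd h hn⟩
  choose e he using h
  -- Two first divergences of one program coincide: both lie beyond the threshold, so the smaller
  -- would violate minimality of the larger.
  have hinj : Set.InjOn (fun n => Encodable.encode (e n)) postSimpleSet := by
    intro m hm n hn hmn
    have hmn : e m = e n := Encodable.encode_injective hmn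
    obtain ⟨a, hlt, h1, h2⟩ := he m hm
    obtain ⟨b, hlt', h1', h2'⟩ := he n hn
    rw [hmn] at hlt h1 h2
    rcases lt_trichotomy (Nat.pair m a) (Nat.pair n b) with h | h | h
    · exact absurd (h2' _ h (by simpa using hlt)) h1
    · exact (Nat.pair_eq_pair.1 h).1
    · exact absurd (h2 _ h (by simpa using hlt')) h1'
  set k := hfin.toFinset.card
  have h1 : ((Finset.range (2 * k + 1)).filter (· ∈ postSimpleSet)).card ≤ (Finset.range k).card :=
    Finset.card_le_card_of_injOn (fun n => Encodable.encode (e n))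
      (fun n hn => by
        simp only [Finset.coe_filter, Finset.mem_range, Set.mem_ofPred_eq] at hn
        obtain ⟨a, hlt, -⟩ := he n hn.2
        simp only [Finset.coe_range, Set.mem_Iio]
        omega)
      (hinj.mono fun n hn => by simp at hn; exact hn.2)
  have h2 : ((Finset.range (2 * k + 1)).filter (· ∉ postSimpleSet)).card ≤ k :=
    Finset.card_le_card fun n hn => by simpa using (Finset.mem_filter.1 hn).2
  have h3 := Finset.card_filter_add_card_filter_not (s := Finset.range (2 * k + 1))
    (· ∈ postSimpleSet)
  simp only [Finset.card_range] at h1 h3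
  omega

/-! ### Coding a Σ₂ set into the finiteness of classes. -/

namespace EquivStructure

/-- For each `Σ₂` set `S` there is a computable equivalence structure, with classes indexed by
natural numbers, in which exactly the classes with index outside `S` are infinite. -/
theorem exists_infinite_iff_notMem {S : Set ℕ} (hS : SigmaTwo fun n => n ∈ S) :
    ∃ B : EquivStructure, B.IsComputable ∧ ∃ π : ℕ → ℕ, Computable π ∧
      (∀ x ∈ B.univ, ∀ y ∈ B.univ, B.E x y ↔ π x = π y) ∧
      (∀ x ∈ B.univ, (B.eqClass x).Infinite ↔ π x ∉ S) ∧ ∀ n ∉ S, ∃ x ∈ B.univ, π x = n := by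
  classical
  obtain ⟨R, hR, h⟩ := hS
  -- By stage `s`, every candidate witness `a ≤ z` for `n ∈ S` has been refuted.
  let stage : (ℕ × ℕ) × ℕ → Prop := fun x => ∀ a < x.1.2 + 1, ∃ b < x.2 + 1, ¬ R (x.1.1, a, b)
  have hstage : ComputablePred stage :=
    ComputablePred.ball_lt (p := fun y : ((ℕ × ℕ) × ℕ) × ℕ =>
      ∃ b < y.1.2 + 1, ¬ R (y.1.1.1, y.2, b))
      (ComputablePred.bex_lt (p := fun z : (((ℕ × ℕ) × ℕ) × ℕ) × ℕ =>
          ¬ R (z.1.1.1.1, z.1.2, z.2))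
        (hR.comp ((Computable.fst.comp (Computable.fst.comp (Computable.fst.comp
          Computable.fst))).pair ((Computable.snd.comp Computable.fst).pair Computable.snd))).not
        (Computable.succ.comp (Computable.snd.comp Computable.fst)))
      (Computable.succ.comp (Computable.snd.comp Computable.fst))
  -- Recording the first such stage makes the universe decidable and gives class `n` at most one
  -- element for each `z`.
  let first : (ℕ × ℕ) × ℕ → Prop := fun x => stage x ∧ ∀ s < x.2, ¬ stage (x.1, s)
  have hfirst : ComputablePred first :=
    hstage.and (ComputablePred.ball_lt (p := fun y : ((ℕ × ℕ) × ℕ) × ℕ => ¬ stage (y.1.1, y.2))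
      (hstage.comp ((Computable.fst.comp Computable.fst).pair Computable.snd)).not Computable.snd)
  have first_unique : ∀ {n z s t}, first ((n, z), s) → first ((n, z), t) → s = t := by
    intro n z s t hs ht
    rcases lt_trichotomy s t with hlt | heq | hlt
    · exact absurd hs.1 (ht.2 s hlt)
    · exact heq
    · exact absurd ht.1 (hs.2 t hlt)
  have first_exists : ∀ {n}, n ∉ S → ∀ z, ∃ s, first ((n, z), s) := by
    intro n hn z
    have hb : ∀ a, ∃ b, ¬ R (n, a, b) := by
      simpa using (not_congr (h n)).1 hn
    choose g hg using hb
    have hex : ∃ s, stage ((n, z), s) :=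
      ⟨(Finset.range (z + 1)).sup g, fun a ha =>
        ⟨g a, Nat.lt_succ_of_le (Finset.le_sup (Finset.mem_range.2 ha)), hg a⟩⟩
    exact ⟨Nat.find hex, Nat.find_spec hex, fun s hs => Nat.find_min hex hs⟩
  let tup : ℕ → (ℕ × ℕ) × ℕ := fun x => ((x.unpair.1, x.unpair.2.unpair.1), x.unpair.2.unpair.2)
  have htup : Computable tup :=
    ((Computable.fst.comp Computable.unpair).pair (Computable.fst.comp
      (Computable.unpair.comp (Computable.snd.comp Computable.unpair)))).pair
      (Computable.snd.comp (Computable.unpair.comp (Computable.snd.comp Computable.unpair)))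
  have hπ : Computable fun x : ℕ => x.unpair.1 := Computable.fst.comp Computable.unpair
  let B : EquivStructure :=
    { univ := {x | first (tup x)}
      E := fun x y => (first (tup x) ∧ first (tup y)) ∧ x.unpair.1 = y.unpair.1
      computable_univ := hfirst.comp htup
      mem_of_rel := fun x y h => h.1
      refl := fun x h => ⟨⟨h, h⟩, rfl⟩
      symm := fun x y h => ⟨h.1.symm, h.2.symm⟩
      trans := fun x y z h h' => ⟨⟨h.1.1, h'.1.2⟩, h.2.trans h'.2⟩ }
  have hBE : ∀ x ∈ B.univ, ∀ y ∈ B.univ, B.E x y ↔ x.unpair.1 = y.unpair.1 :=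
    fun x hx y hy => ⟨fun h => h.2, fun h => ⟨⟨hx, hy⟩, h⟩⟩
  refine ⟨B, ((hfirst.comp (htup.comp Computable.fst)).and (hfirst.comp
    (htup.comp Computable.snd))).and (.eq (hπ.comp Computable.fst) (hπ.comp Computable.snd)),
    fun x => x.unpair.1, hπ, hBE, fun x hx => ⟨fun hinf hxS => hinf ?_, fun hxS => ?_⟩,
    fun n hn => ?_⟩
  · obtain ⟨a, ha⟩ := (h _).1 hxS
    -- A true witness `a` is never refuted, so only `z < a` contribute elements.
    refine Set.Finite.of_finite_image (f := fun y : ℕ => y.unpair.2.unpair.1)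
      ((Set.finite_Iio a).subset ?_) ?_
    · rintro _ ⟨y, hy, rfl⟩
      by_contra hlt
      obtain ⟨b, -, hb⟩ := hy.1.2.1 a (Nat.lt_succ_of_le (not_lt.1 hlt))
      exact hb (by simpa [tup, ← hy.2] using ha b)
    · intro y hy z hz hyz
      have h1 : y.unpair.1 = z.unpair.1 := hy.2.symm.trans hz.2
      have h2 : y.unpair.2.unpair.1 = z.unpair.2.unpair.1 := hyz
      have hy' : first ((z.unpair.1, z.unpair.2.unpair.1), y.unpair.2.unpair.2) := by
        rw [← h1, ← h2]; exact hy.1.2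
      have h3 := first_unique hy' hz.1.2
      rw [← Nat.pair_unpair y, ← Nat.pair_unpair z, h1, ← Nat.pair_unpair y.unpair.2, h2, h3,
        Nat.pair_unpair]
  · choose s hs using first_exists hxS
    refine Set.infinite_of_injective_forall_mem
      (f := fun z => Nat.pair x.unpair.1 (Nat.pair z (s z))) (fun z w hzw => ?_) fun z => ?_
    · exact (Nat.pair_eq_pair.1 (Nat.pair_eq_pair.1 hzw).2).1
    · exact ⟨⟨hx, by simpa [tup] using hs z⟩, by simp⟩
  · obtain ⟨s, hs⟩ := first_exists hn 0
    exact ⟨Nat.pair n (Nat.pair 0 s), by simpa [B, tup] using hs, by simp⟩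

/-! ### Least representatives, embeddings and the structure without `0'`-computable embeddings. -/

variable {A B C : EquivStructure}

theorem eqClass_eq_iff {x y : ℕ} (hx : x ∈ A.univ) : A.eqClass x = A.eqClass y ↔ A.E x y := by
  constructor
  · intro h
    have : x ∈ A.eqClass y := h ▸ A.refl x hx
    exact A.symm _ _ this
  · intro h
    ext z
    exact ⟨fun hz => A.trans _ _ _ (A.symm _ _ h) hz, fun hz => A.trans _ _ _ h hz⟩

/-- `x` is the least element of its equivalence class. -/
def IsLeastRep (A : EquivStructure) (x : ℕ) : Prop := x ∈ A.univ ∧ ∀ y < x, ¬ A.E x y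

/-- The least element of the equivalence class of `x`. -/
def rep (A : EquivStructure) (x : ℕ) : ℕ := sInf (A.eqClass x)

theorem rel_rep {x : ℕ} (hx : x ∈ A.univ) : A.E x (A.rep x) :=
  Nat.sInf_mem (s := A.eqClass x) ⟨x, A.refl x hx⟩

theorem isLeastRep_rep {x : ℕ} (hx : x ∈ A.univ) : A.IsLeastRep (A.rep x) :=
  ⟨(A.mem_of_rel _ _ (rel_rep hx)).2, fun _ hy h =>
    Nat.notMem_of_lt_sInf hy (A.trans _ _ _ (rel_rep hx) h)⟩

theorem rep_eq_rep_iff {x y : ℕ} (hx : x ∈ A.univ) (hy : y ∈ A.univ) :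
    A.rep x = A.rep y ↔ A.E x y := by
  constructor
  · intro h
    exact A.trans _ _ _ (rel_rep hx) (h ▸ A.symm _ _ (rel_rep hy))
  · intro h
    rw [rep, (eqClass_eq_iff hx).2 h, rep]

theorem IsLeastRep.eq_of_rel {x y : ℕ} (hx : A.IsLeastRep x) (hy : A.IsLeastRep y)
    (h : A.E x y) : x = y := by
  rcases lt_trichotomy x y with hlt | heq | hlt
  · exact absurd (A.symm _ _ h) (hy.2 x hlt)
  · exact heq
  · exact absurd h (hx.2 y hlt)

theorem IsComputable.computablePred_isLeastRep (hA : A.IsComputable) :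
    ComputablePred A.IsLeastRep :=
  A.computable_univ.and
    (ComputablePred.ball_lt (p := fun x : ℕ × ℕ => ¬ A.E x.1 x.2) hA.not Computable.id)

theorem infinite_isLeastRep (hA : A.infiniteClasses.Infinite) : {x | A.IsLeastRep x}.Infinite := by
  intro hfin
  refine hA ((hfin.image A.eqClass).subset ?_)
  rintro c ⟨⟨a, ha, rfl⟩, -⟩
  exact ⟨A.rep a, isLeastRep_rep ha, ((eqClass_eq_iff ha).2 (rel_rep ha)).symm⟩

/-- Every equivalence structure embeds into each one with infinitely many infinite classes. -/
theorem nonempty_embedding_of_infinite (hB : B.infiniteClasses.Infinite) :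
    Nonempty (Embedding A B) := by
  let c : ℕ ↪ B.infiniteClasses := hB.natEmbedding _
  -- Indexing by `x` itself, not by its rank in its class, is already injective because the target
  -- class is infinite.
  let f : ℕ → ℕ := fun x => Nat.nth (· ∈ (c (A.rep x) : Set ℕ)) x
  have hf : ∀ x, f x ∈ (c (A.rep x) : Set ℕ) := fun x =>
    Nat.nth_mem_of_infinite (p := (· ∈ (c (A.rep x) : Set ℕ))) (c (A.rep x)).2.2 x
  have hcls : ∀ x, f x ∈ B.univ ∧ (c (A.rep x) : Set ℕ) = B.eqClass (f x) := fun x => by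
    obtain ⟨⟨a, ha, hc⟩, -⟩ := (c (A.rep x)).2
    have h : B.E a (f x) := by simpa [hc, eqClass] using hf x
    exact ⟨(B.mem_of_rel _ _ h).2, hc.trans ((eqClass_eq_iff ha).2 h)⟩
  have hrel : ∀ x ∈ A.univ, ∀ y ∈ A.univ, A.E x y ↔ B.E (f x) (f y) := fun x hx y hy => by
    rw [← eqClass_eq_iff (hcls x).1, ← (hcls x).2, ← (hcls y).2, Subtype.coe_inj,
      c.injective.eq_iff, rep_eq_rep_iff hx hy]
  refine ⟨⟨fun x => ⟨f x, (hcls x).1⟩, fun x y hxy => ?_, fun x y => hrel x x.2 y y.2⟩⟩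
  have hfxy : f x = f y := congrArg Subtype.val hxy
  have hrep : A.rep x = A.rep y := (rep_eq_rep_iff x.2 y.2).2
    ((hrel x x.2 y y.2).2 (by rw [hfxy]; exact B.refl _ (hcls y).1))
  have : Nat.nth (· ∈ (c (A.rep y) : Set ℕ)) x = Nat.nth (· ∈ (c (A.rep y) : Set ℕ)) y := by
    simpa only [f, hrep] using hfxy
  exact Subtype.ext (Nat.nth_injective (p := (· ∈ (c (A.rep y) : Set ℕ))) (c (A.rep y)).2.2 this)

/-- The composition of embeddings. -/
def Embedding.trans (f : Embedding A B) (g : Embedding B C) : Embedding A C where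
  toFun x := g.toFun (f.toFun x)
  injective := g.injective.comp f.injective
  rel_iff x y := (f.rel_iff x y).trans (g.rel_iff _ _)

theorem Embedding.ComputableFrom.trans {o : ℕ → ℕ} {f : Embedding A B} {g : Embedding B C}
    (hf : f.ComputableFrom o) (hg : g.ComputableFrom o) : (f.trans g).ComputableFrom o := by
  refine RecursiveIn.iff_nat.2 ((Nat.RecursiveIn.comp (RecursiveIn.iff_nat.1 hg)
    (RecursiveIn.iff_nat.1 hf)).of_eq fun n => Part.ext fun y => ?_)
  refine Part.mem_bind_iff.trans ⟨?_, ?_⟩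
  · rintro ⟨_, ⟨hn, rfl⟩, _, rfl⟩
    exact ⟨hn, rfl⟩
  · rintro ⟨hn, rfl⟩
    exact ⟨_, ⟨hn, rfl⟩, (f.toFun ⟨n, hn⟩).2, rfl⟩

theorem Embedding.infinite_eqClass (f : Embedding A B) (x : A.univ)
    (hx : (A.eqClass x).Infinite) : (B.eqClass (f.toFun x)).Infinite := by
  have hsub : ∀ y ∈ A.eqClass x, y ∈ A.univ := fun y hy => (A.mem_of_rel _ _ hy).2
  have : Infinite (A.eqClass x) := hx.to_subtype
  refine Set.infinite_of_injective_forall_mem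
    (f := fun y : A.eqClass x => (f.toFun ⟨y, hsub y y.2⟩ : ℕ)) (fun y z hyz => ?_) fun y => ?_
  · simpa [Subtype.ext_iff] using f.injective (Subtype.ext hyz)
  · exact (f.rel_iff x ⟨y, hsub y y.2⟩).1 y.2

/-- The structure with infinitely many classes, all of them infinite. -/
def omegaOmega : EquivStructure where
  univ := Set.univ
  E x y := x.unpair.1 = y.unpair.1
  computable_univ := (ComputablePred.eq Computable.id Computable.id).of_eq fun _ => by simp
  mem_of_rel _ _ _ := ⟨trivial, trivial⟩
  refl _ _ := rfl
  symm _ _ := Eq.symm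
  trans _ _ _ := Eq.trans

theorem isComputable_omegaOmega : omegaOmega.IsComputable :=
  .eq (Computable.fst.comp (Computable.unpair.comp Computable.fst))
    (Computable.fst.comp (Computable.unpair.comp Computable.snd))

theorem infinite_eqClass_omegaOmega (a : ℕ) : (omegaOmega.eqClass a).Infinite :=
  Set.infinite_of_injective_forall_mem (f := fun z => Nat.pair a.unpair.1 z)
    (fun _ _ h => (Nat.pair_eq_pair.1 h).2) fun z => by simp [eqClass, omegaOmega]

theorem finiteClasses_omegaOmega : omegaOmega.finiteClasses = ∅ := by
  refine Set.eq_empty_of_forall_notMem ?_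
  rintro c ⟨⟨a, -, rfl⟩, hfin⟩
  exact infinite_eqClass_omegaOmega a hfin

theorem infiniteClasses_omegaOmega : omegaOmega.infiniteClasses.Infinite := by
  refine Set.infinite_of_injective_forall_mem (f := fun n => omegaOmega.eqClass (Nat.pair n 0))
    (fun m n h => ?_) fun n => ⟨⟨_, trivial, rfl⟩, infinite_eqClass_omegaOmega _⟩
  simpa [omegaOmega] using (eqClass_eq_iff (A := omegaOmega) trivial).1 h

/-- There is a computable structure with infinitely many infinite classes in which no infinite
`Σ₂` set consists of pairwise inequivalent elements of infinite classes. -/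
theorem exists_forall_sigmaTwo_finite :
    ∃ B : EquivStructure, B.IsComputable ∧ B.infiniteClasses.Infinite ∧
      (∀ T : Set ℕ, B.IsTransversalOf B.infPart T → T.Infinite) ∧
      ∀ W ⊆ B.infPart, (∀ x ∈ W, ∀ y ∈ W, B.E x y → x = y) → SigmaTwo (fun x => x ∈ W) →
        W.Finite := by
  obtain ⟨B, hB, π, hπ, hE, hinf, hsurj⟩ := exists_infinite_iff_notMem sigmaTwo_postSimpleSet
  refine ⟨B, hB, ?_, fun T hT => ?_, fun W hW hne hW2 => ?_⟩
  · have : Infinite (postSimpleSetᶜ : Set ℕ) := infinite_compl_postSimpleSet.to_subtype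
    choose! g hg hπg using hsurj
    refine Set.infinite_of_injective_forall_mem
      (f := fun n : (postSimpleSetᶜ : Set ℕ) => B.eqClass (g n)) (fun m n h => ?_) fun n =>
      ⟨⟨_, hg n n.2, rfl⟩, (hinf _ (hg n n.2)).2 (by rw [hπg n n.2]; exact n.2)⟩
    have h' := (hE _ (hg m m.2) _ (hg n n.2)).1 ((eqClass_eq_iff (hg m m.2)).1 h)
    rw [hπg m m.2, hπg n n.2] at h'
    exact Subtype.ext h'
  · intro hfin
    -- The indices of a transversal cover the whole complement of the simple set.
    refine infinite_compl_postSimpleSet ((hfin.image π).subset fun n hn => ?_)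
    obtain ⟨x, hx, rfl⟩ := hsurj n hn
    obtain ⟨y, hy, hyx⟩ := hT.2.2 x ⟨hx, (hinf x hx).2 hn⟩
    exact ⟨y, hy, (hE _ (hT.1 hy).1 _ hx).1 hyx⟩
  · by_contra hWinf
    have hinj : Set.InjOn π W := fun x hx y hy h =>
      hne x hx y hy ((hE _ (hW hx).1 _ (hW hy).1).2 h)
    have himg : SigmaTwo fun n => n ∈ π '' W :=
      (SigmaTwo.ex (p := fun z : ℕ × ℕ => z.2 ∈ W ∧ π z.2 = z.1)
        ((hW2.comp Computable.snd).and (.of_computablePred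
          (.eq (hπ.comp Computable.snd) Computable.fst)))).of_eq fun n => Iff.rfl
    obtain ⟨_, ⟨x, hx, rfl⟩, hmem⟩ :=
      postSimpleSet_inter_nonempty himg (Set.Infinite.image hinj hWinf)
    exact (hinf x (hW hx).1).1 (hW hx).2 hmem

/-- The images of the least representatives form an infinite Σ₂ set of pairwise inequivalent
elements of infinite classes, which `hB` forbids. -/
theorem not_computableFrom_zeroJump (hA : A.IsComputable) (hinf : A.infiniteClasses.Infinite)
    (hfin : A.finiteClasses = ∅)
    (hB : ∀ W ⊆ B.infPart, (∀ x ∈ W, ∀ y ∈ W, B.E x y → x = y) → SigmaTwo (fun x => x ∈ W) →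
        W.Finite) (f : Embedding A B) : ¬ f.ComputableFrom zeroJump := by
  intro hf
  have hall : ∀ x ∈ A.univ, (A.eqClass x).Infinite := fun x hx h =>
    Set.eq_empty_iff_forall_notMem.1 hfin _ ⟨⟨x, hx, rfl⟩, h⟩
  let W : Set ℕ := {y | ∃ x, A.IsLeastRep x ∧ y ∈ f.toPFun x}
  have hW : SigmaTwo fun y => y ∈ W :=
    (SigmaTwo.ex (p := fun z : ℕ × ℕ => A.IsLeastRep z.2 ∧ z.1 ∈ f.toPFun z.2)
      ((SigmaTwo.of_computablePred (hA.computablePred_isLeastRep.comp Computable.snd)).and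
      ((TuringReducible.sigmaTwo_graph hf).comp (Computable.snd.pair Computable.fst)))).of_eq
      fun _ => Iff.rfl
  have hWfin : W.Finite := by
    refine hB W ?_ ?_ hW
    · rintro _ ⟨x, -, hx, rfl⟩
      exact ⟨(f.toFun ⟨x, hx⟩).2, f.infinite_eqClass ⟨x, hx⟩ (hall x hx)⟩
    · rintro _ ⟨x, hxr, hx, rfl⟩ _ ⟨y, hyr, hy, rfl⟩ h
      obtain rfl := hxr.eq_of_rel hyr ((f.rel_iff ⟨x, hx⟩ ⟨y, hy⟩).2 h)
      rfl
  have : Infinite {x | A.IsLeastRep x} := (infinite_isLeastRep hinf).to_subtype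
  refine Set.infinite_of_injective_forall_mem (s := W)
    (f := fun x : {x | A.IsLeastRep x} => (f.toFun ⟨x, x.2.1⟩ : ℕ)) (fun x y h => ?_)
    (fun x => ⟨x, x.2, x.2.1, rfl⟩) hWfin
  simpa [Subtype.ext_iff] using f.injective (Subtype.ext h)

end EquivStructure

/-! ### Bounded search and counting as stagewise approximations. -/

open Classical in
/-- The least `b < t` satisfying `p`, or `t` if there is none. -/
def boundedSearch (p : ℕ → Prop) (t : ℕ) : ℕ :=
  Nat.find (⟨t, Or.inr le_rfl⟩ : ∃ b, p b ∨ t ≤ b)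

theorem boundedSearch_eq_iff {p : ℕ → Prop} {t b : ℕ} :
    boundedSearch p t = b ↔ (p b ∨ t ≤ b) ∧ ∀ a < b, ¬ p a ∧ a < t := by
  classical
  simp [boundedSearch, Nat.find_eq_iff]

theorem computable_boundedSearch {α : Type*} [Primcodable α] {p : α × ℕ → Prop} {t : α → ℕ}
    (hp : ComputablePred p) (ht : Computable t) :
    Computable fun x => boundedSearch (fun b => p (x, b)) (t x) := by
  classical
  exact (Computable.find (P := fun x b => p (x, b) ∨ t x ≤ b)
    (hp.or (.le (ht.comp Computable.fst) Computable.snd))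
    fun x => ⟨t x, Or.inr le_rfl⟩).of_eq fun x => by simp [boundedSearch]

/-- Only the finitely many `a < b` must be excluded, so one stage serves for all of them. -/
theorem eventually_boundedSearch_eq {p : ℕ → ℕ → Prop} {b : ℕ}
    (hb : ∀ᶠ t in Filter.atTop, p t b) (hlt : ∀ a < b, ∀ᶠ t in Filter.atTop, ¬ p t a) :
    ∀ᶠ t in Filter.atTop, boundedSearch (p t) t = b := by
  have h : ∀ᶠ t in Filter.atTop, ∀ a ∈ Set.Iio b, ¬ p t a :=
    (Filter.eventually_all_finite (Set.finite_Iio b)).2 hlt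
  filter_upwards [hb, h, Filter.eventually_ge_atTop b] with t h1 h2 h3
  exact boundedSearch_eq_iff.2 ⟨Or.inl h1, fun a ha => ⟨h2 a ha, lt_of_lt_of_le ha h3⟩⟩

open Classical in
theorem computable_count {α : Type*} [Primcodable α] {p : α × ℕ → Prop} {t : α → ℕ}
    (hp : ComputablePred p) (ht : Computable t) :
    Computable fun x => Nat.count (fun i => p (x, i)) (t x) := by
  have h : Computable fun x =>
      (Nat.rec 0 (fun i c => c + if p (x, i) then 1 else 0) (t x) : ℕ) :=
    Computable.nat_rec ht (Computable.const 0)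
      (Primrec.nat_add.to_comp.comp (Computable.snd.comp Computable.snd)
        ((hp.comp (Computable.fst.pair (Computable.fst.comp Computable.snd))).ite'
          (Computable.const 1) (Computable.const 0))).to₂
  have key : ∀ x n, (Nat.rec 0 (fun i c => c + if p (x, i) then 1 else 0) n : ℕ) =
      Nat.count (fun i => p (x, i)) n := fun x n => by
    induction n with
    | zero => simp
    | succ n ih => rw [Nat.count_succ, ← ih]
  exact h.of_eq fun x => key x (t x)

open Classical in
theorem count_le_encard (p : ℕ → Prop) (t : ℕ) : (Nat.count p t : ℕ∞) ≤ {x | p x}.encard := by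
  rw [Nat.count_eq_card_filter_range, ← Set.encard_coe_eq_coe_finsetCard]
  exact Set.encard_le_encard fun x hx => by simpa using (Finset.mem_filter.1 hx).2

open Classical in
theorem eventually_le_count {p : ℕ → Prop} {n : ℕ} (h : (n : ℕ∞) ≤ {x | p x}.encard) :
    ∀ᶠ t in Filter.atTop, n ≤ Nat.count p t := by
  obtain ⟨s, hs, hcard⟩ := Set.exists_subset_encard_eq h
  have hfin : s.Finite := Set.finite_of_encard_eq_coe hcard
  obtain ⟨m, hm⟩ := hfin.bddAbove
  filter_upwards [Filter.eventually_gt_atTop m] with t ht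
  rw [Nat.count_eq_card_filter_range]
  rw [hfin.encard_eq_coe_toFinset_card, Nat.cast_inj] at hcard
  rw [← hcard]
  refine Finset.card_le_card fun x hx => ?_
  have hx := hfin.mem_toFinset.1 hx
  exact Finset.mem_filter.2 ⟨Finset.mem_range.2 ((hm hx).trans_lt ht), hs hx⟩

/-- This is the form of hypothesis used by `Nat.nth_mem` and `Nat.count_nth`; it is vacuous for
infinite sets. -/
theorem lt_card_toFinset_of_lt_encard {p : ℕ → Prop} {n : ℕ} (h : (n : ℕ∞) < {x | p x}.encard) :
    ∀ hf : (Set.ofPred p).Finite, n < hf.toFinset.card := fun hf => by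
  have h' : (n : ℕ∞) < (Set.ofPred p).encard := h
  rw [hf.encard_eq_coe_toFinset_card] at h'
  exact_mod_cast h'

/-! ### Embeddings from limit computable assignments of classes. -/

namespace EquivStructure

variable {A B : EquivStructure}

theorem rel_congr {x y : ℕ} (h : A.E x y) : A.E x = A.E y :=
  (eqClass_eq_iff (A.mem_of_rel _ _ h).1).2 h

open Classical in
theorem count_lt_encard {x y : ℕ} (h : A.E x y) :
    (Nat.count (A.E x) y : ℕ∞) < (A.eqClass x).encard := by
  have h1 := count_le_encard (A.E x) (y + 1)
  rw [Nat.count_succ, if_pos h] at h1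
  exact lt_of_lt_of_le (by exact_mod_cast Nat.lt_succ_self _) h1

theorem boundedSearch_rel_eq_rep {x : ℕ} (hx : x ∈ A.univ) :
    boundedSearch (A.E x) x = A.rep x :=
  boundedSearch_eq_iff.2 ⟨Or.inl (rel_rep hx), fun _ ha => ⟨Nat.notMem_of_lt_sInf ha,
    ha.trans_le (Nat.sInf_le (A.refl x hx))⟩⟩

open Classical in
/-- A limit computable injection `h` of classes, given on least representatives, that does not
decrease sizes yields an embedding computable in the halting problem. -/
theorem exists_computableFrom_of_limit (hA : A.IsComputable) (hB : B.IsComputable)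
    {H : ℕ → ℕ → ℕ} {h : ℕ → ℕ} (hH : Computable₂ H)
    (hlim : ∀ x, ∀ᶠ t in Filter.atTop, H x t = h x)
    (hrep : ∀ x, A.IsLeastRep x → B.IsLeastRep (h x))
    (hsize : ∀ x, A.IsLeastRep x → (A.eqClass x).encard ≤ (B.eqClass (h x)).encard)
    (hinj : ∀ x y, A.IsLeastRep x → A.IsLeastRep y → h x = h y → x = y) :
    ∃ f : Embedding A B, f.ComputableFrom zeroJump := by
  -- An element goes to the element of the same rank in the assigned class, which exists because
  -- sizes do not decrease.
  let f : ℕ → ℕ := fun x => Nat.nth (B.E (h (A.rep x))) (Nat.count (A.E x) x)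
  have hf : ∀ x ∈ A.univ, B.E (h (A.rep x)) (f x) ∧
      Nat.count (B.E (h (A.rep x))) (f x) = Nat.count (A.E x) x := fun x hx => by
    have hlt := lt_card_toFinset_of_lt_encard (p := B.E (h (A.rep x)))
      ((count_lt_encard (A.refl x hx)).trans_le
      ((congrArg Set.encard ((eqClass_eq_iff hx).2 (rel_rep hx))).trans_le
      (hsize _ (isLeastRep_rep hx))))
    exact ⟨Nat.nth_mem _ hlt, Nat.count_nth hlt⟩
  have hmem : ∀ x ∈ A.univ, f x ∈ B.univ := fun x hx => (B.mem_of_rel _ _ (hf x hx).1).2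
  have hrel : ∀ x ∈ A.univ, ∀ y ∈ A.univ, A.E x y ↔ B.E (f x) (f y) := fun x hx y hy => by
    rw [← rep_eq_rep_iff hx hy]
    constructor
    · intro hxy
      have h1 := (hf x hx).1
      rw [hxy] at h1
      exact B.trans _ _ _ (B.symm _ _ h1) (hf y hy).1
    · intro hxy
      refine hinj _ _ (isLeastRep_rep hx) (isLeastRep_rep hy) ((hrep _ (isLeastRep_rep hx)).eq_of_rel
        (hrep _ (isLeastRep_rep hy)) ?_)
      exact B.trans _ _ _ (hf x hx).1 (B.trans _ _ _ hxy (B.symm _ _ (hf y hy).1))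
  have hfinj : ∀ x ∈ A.univ, ∀ y ∈ A.univ, f x = f y → x = y := fun x hx y hy hxy => by
    have hE : A.E x y := (hrel x hx y hy).2 (hxy ▸ B.refl _ (hmem x hx))
    have h1 := (hf x hx).2
    rw [hxy, (rep_eq_rep_iff hx hy).2 hE, (hf y hy).2, ← rel_congr hE] at h1
    exact (Nat.count_injective hE (A.refl x hx) h1).symm
  refine ⟨⟨fun x => ⟨f x, hmem x x.2⟩, fun x y hxy =>
    Subtype.ext (hfinj x x.2 y y.2 (congrArg Subtype.val hxy)), fun x y => hrel x x.2 y y.2⟩, ?_⟩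
  let r : ℕ → ℕ := fun x => boundedSearch (A.E x) x
  have hr : Computable r := computable_boundedSearch (p := fun x => A.E x.1 x.2) hA Computable.id
  let s : ℕ → ℕ → ℕ := fun x t => boundedSearch (fun y => B.E (H (r x) t) y ∧
    Nat.count (B.E (H (r x) t)) y = Nat.count (A.E x) x) t
  have hHr : Computable fun z : (ℕ × ℕ) × ℕ => H (r z.1.1) z.1.2 :=
    hH.comp (hr.comp (Computable.fst.comp Computable.fst)) (Computable.snd.comp Computable.fst)
  have hcB : Computable fun z : (ℕ × ℕ) × ℕ => Nat.count (B.E (H (r z.1.1) z.1.2)) z.2 :=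
    computable_count (p := fun w : ((ℕ × ℕ) × ℕ) × ℕ => B.E (H (r w.1.1.1) w.1.1.2) w.2)
      (hB.comp ((hHr.comp Computable.fst).pair Computable.snd)) Computable.snd
  have hcA : Computable fun x : ℕ => Nat.count (A.E x) x :=
    computable_count (p := fun w : ℕ × ℕ => A.E w.1 w.2) hA Computable.id
  have hs : Computable₂ s :=
    computable_boundedSearch (p := fun z : (ℕ × ℕ) × ℕ => B.E (H (r z.1.1) z.1.2) z.2 ∧
      Nat.count (B.E (H (r z.1.1) z.1.2)) z.2 = Nat.count (A.E z.1.1) z.1.1)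
      ((hB.comp (hHr.pair Computable.snd)).and
        (.eq hcB (hcA.comp (Computable.fst.comp Computable.fst)))) Computable.snd
  refine turingReducible_zeroJump_of_limit hs A.computable_univ fun x hx => ?_
  have hrx : r x = A.rep x := boundedSearch_rel_eq_rep hx
  refine eventually_boundedSearch_eq ?_ fun a ha => ?_
  · filter_upwards [hlim (A.rep x)] with t ht
    rw [hrx, ht]
    exact hf x hx
  · filter_upwards [hlim (A.rep x)] with t ht
    rw [hrx, ht]
    rintro ⟨h1, h2⟩
    exact (Nat.count_strict_mono h1 ha).ne (h2.trans (hf x hx).2.symm)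

open Classical in
/-- Stage `t` of a greedy search for representatives in `B`: beyond `N`, each least
representative `x` of a class of `A` is assigned the next representative of a class of `B` that
has at stage `t` at least as many elements as the class of `x`. -/
def greedyStage (A B : EquivStructure) (M N t : ℕ) : ℕ → ℕ
  | 0 => M
  -- The value at `x + 1` is the image of `x` when `x` is treated and a carried bound otherwise.
  -- Searching above the previous value is what yields injectivity.
  | x + 1 => if N ≤ x ∧ A.IsLeastRep x then
      boundedSearch (fun b => (greedyStage A B M N t x < b ∧ B.IsLeastRep b) ∧
        Nat.count (A.E x) t ≤ Nat.count (B.E b) t) t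
    else greedyStage A B M N t x

open Classical in
/-- The limit of `greedyStage`. -/
def greedyLimit (A B : EquivStructure) (M N : ℕ) : ℕ → ℕ
  | 0 => M
  | x + 1 => if N ≤ x ∧ A.IsLeastRep x then
      sInf {b | (greedyLimit A B M N x < b ∧ B.IsLeastRep b) ∧
        (A.eqClass x).encard ≤ (B.eqClass b).encard}
    else greedyLimit A B M N x

theorem computable_greedyStage (hA : A.IsComputable) (hB : B.IsComputable) (M N : ℕ) :
    Computable₂ fun x t => greedyStage A B M N t x := by
  classical
  let step : ((ℕ × ℕ) × (ℕ × ℕ)) → ℕ := fun z =>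
    if N ≤ z.2.1 ∧ A.IsLeastRep z.2.1 then
      boundedSearch (fun b => (z.2.2 < b ∧ B.IsLeastRep b) ∧
        Nat.count (A.E z.2.1) z.1.2 ≤ Nat.count (B.E b) z.1.2) z.1.2
    else z.2.2
  have hx : Computable fun z : (ℕ × ℕ) × (ℕ × ℕ) => z.2.1 := Computable.fst.comp Computable.snd
  have hi : Computable fun z : (ℕ × ℕ) × (ℕ × ℕ) => z.2.2 := Computable.snd.comp Computable.snd
  have ht : Computable fun z : (ℕ × ℕ) × (ℕ × ℕ) => z.1.2 := Computable.snd.comp Computable.fst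
  have hcA : Computable fun z : ((ℕ × ℕ) × (ℕ × ℕ)) × ℕ =>
      Nat.count (A.E z.1.2.1) z.1.1.2 :=
    computable_count (p := fun w : (((ℕ × ℕ) × (ℕ × ℕ)) × ℕ) × ℕ => A.E w.1.1.2.1 w.2)
      (hA.comp ((hx.comp (Computable.fst.comp Computable.fst)).pair Computable.snd))
      (ht.comp Computable.fst)
  have hcB : Computable fun z : ((ℕ × ℕ) × (ℕ × ℕ)) × ℕ => Nat.count (B.E z.2) z.1.1.2 :=
    computable_count (p := fun w : (((ℕ × ℕ) × (ℕ × ℕ)) × ℕ) × ℕ => B.E w.1.2 w.2)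
      (hB.comp ((Computable.snd.comp Computable.fst).pair Computable.snd))
      (ht.comp Computable.fst)
  have hstep : Computable step := by
    refine ComputablePred.ite' (c := fun z : (ℕ × ℕ) × (ℕ × ℕ) => N ≤ z.2.1 ∧ A.IsLeastRep z.2.1)
      ((ComputablePred.le (Computable.const N) hx).and
      (hA.computablePred_isLeastRep.comp hx)) ?_ hi
    exact computable_boundedSearch (p := fun z : ((ℕ × ℕ) × (ℕ × ℕ)) × ℕ =>
      (z.1.2.2 < z.2 ∧ B.IsLeastRep z.2) ∧
        Nat.count (A.E z.1.2.1) z.1.1.2 ≤ Nat.count (B.E z.2) z.1.1.2)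
      (((ComputablePred.lt (hi.comp Computable.fst) Computable.snd).and
        (hB.computablePred_isLeastRep.comp Computable.snd)).and (.le hcA hcB)) ht
  have hrec : Computable fun z : ℕ × ℕ => (Nat.rec M (fun y i => step (z, y, i)) z.1 : ℕ) :=
    Computable.nat_rec Computable.fst (Computable.const M) hstep.to₂
  have key : ∀ t x w, (Nat.rec M (fun y i => step ((w, t), y, i)) x : ℕ) =
      greedyStage A B M N t x := fun t x w => by
    induction x with
    | zero => rfl
    | succ x ih =>
      simp only [ih]
      rfl
  exact hrec.of_eq fun z => key z.2 z.1 z.1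

/-- Infinitely many candidates leave one above the previous value, so the infimum is attained. -/
theorem greedyLimit_succ {M N x : ℕ} (hNx : N ≤ x) (hx : A.IsLeastRep x)
    (hinf : {b | B.IsLeastRep b ∧ (A.eqClass x).encard ≤ (B.eqClass b).encard}.Infinite) :
    (greedyLimit A B M N x < greedyLimit A B M N (x + 1) ∧
      B.IsLeastRep (greedyLimit A B M N (x + 1))) ∧
      (A.eqClass x).encard ≤ (B.eqClass (greedyLimit A B M N (x + 1))).encard := by
  obtain ⟨b, hb, hlt⟩ := hinf.exists_gt (greedyLimit A B M N x)
  have h := Nat.sInf_mem (s := {b | (greedyLimit A B M N x < b ∧ B.IsLeastRep b) ∧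
        (A.eqClass x).encard ≤ (B.eqClass b).encard}) ⟨b, ⟨hlt, hb.1⟩, hb.2⟩
  rw [greedyLimit, if_pos ⟨hNx, hx⟩]
  exact h

/-- For a finite class of size `n` the count settles at `n`. The correct target eventually shows `n`
elements, while a representative with a smaller class never does. -/
theorem eventually_greedyStage_eq {M N : ℕ}
    (hN : ∀ x, N ≤ x → A.IsLeastRep x → (A.eqClass x).Finite ∧
      {b | B.IsLeastRep b ∧ (A.eqClass x).encard ≤ (B.eqClass b).encard}.Infinite) (x : ℕ) :
    ∀ᶠ t in Filter.atTop, greedyStage A B M N t x = greedyLimit A B M N x := by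
  classical
  induction x with
  | zero => exact Filter.Eventually.of_forall fun _ => rfl
  | succ x ih =>
    by_cases hx : N ≤ x ∧ A.IsLeastRep x
    · obtain ⟨hfin, hinf⟩ := hN x hx.1 hx.2
      have hspec := greedyLimit_succ (M := M) hx.1 hx.2 hinf
      obtain ⟨n, hn⟩ : ∃ n : ℕ, (A.eqClass x).encard = n := ⟨_, hfin.encard_eq_coe⟩
      have hstage : ∀ t, greedyStage A B M N t (x + 1) = boundedSearch
          (fun b => (greedyStage A B M N t x < b ∧ B.IsLeastRep b) ∧
            Nat.count (A.E x) t ≤ Nat.count (B.E b) t) t := fun t => by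
        rw [greedyStage, if_pos hx]
      simp only [hstage]
      refine eventually_boundedSearch_eq ?_ fun a ha => ?_
      · filter_upwards [ih, eventually_le_count (p := B.E (greedyLimit A B M N (x + 1)))
          (hn ▸ hspec.2)] with t ht hle
        rw [ht]
        refine ⟨hspec.1, le_trans ?_ hle⟩
        have h := count_le_encard (A.E x) t
        exact_mod_cast h.trans_eq hn
      · filter_upwards [ih, eventually_le_count (p := A.E x) hn.ge] with t ht hle
        rw [ht]
        rintro ⟨h1, h2⟩
        rw [greedyLimit, if_pos hx] at ha
        refine Nat.notMem_of_lt_sInf ha ⟨h1, ?_⟩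
        rw [hn]
        exact (by exact_mod_cast hle.trans h2 : (n : ℕ∞) ≤ Nat.count (B.E a) t).trans
          (count_le_encard _ t)
    · filter_upwards [ih] with t ht
      rw [greedyStage, greedyLimit, if_neg hx, if_neg hx, ht]

theorem monotone_greedyLimit {M N : ℕ}
    (hN : ∀ x, N ≤ x → A.IsLeastRep x →
      {b | B.IsLeastRep b ∧ (A.eqClass x).encard ≤ (B.eqClass b).encard}.Infinite) :
    Monotone (greedyLimit A B M N) := by
  refine monotone_nat_of_le_succ fun x => ?_
  by_cases hx : N ≤ x ∧ A.IsLeastRep x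
  · exact (greedyLimit_succ hx.1 hx.2 (hN x hx.1 hx.2)).1.1.le
  · rw [greedyLimit, if_neg hx]

/-! ### Comparing class sizes, and the `0'`-computable embedding. -/

open Classical in
/-- An embedding as a total function on `ℕ`, with value `0` outside its domain. -/
def Embedding.extend (f : Embedding A B) (x : ℕ) : ℕ :=
  if h : x ∈ A.univ then f.toFun ⟨x, h⟩ else 0

theorem Embedding.extend_mem (f : Embedding A B) {x : ℕ} (hx : x ∈ A.univ) :
    f.extend x ∈ B.univ := by
  rw [Embedding.extend, dif_pos hx]
  exact (f.toFun ⟨x, hx⟩).2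

theorem Embedding.extend_rel_iff (f : Embedding A B) {x y : ℕ} (hx : x ∈ A.univ)
    (hy : y ∈ A.univ) : A.E x y ↔ B.E (f.extend x) (f.extend y) := by
  rw [Embedding.extend, Embedding.extend, dif_pos hx, dif_pos hy]
  exact f.rel_iff ⟨x, hx⟩ ⟨y, hy⟩

theorem Embedding.encard_eqClass_le (f : Embedding A B) {x : ℕ} (hx : x ∈ A.univ) :
    (A.eqClass x).encard ≤ (B.eqClass (f.extend x)).encard := by
  have hmem : ∀ y ∈ A.eqClass x, y ∈ A.univ := fun y hy => (A.mem_of_rel _ _ hy).2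
  refine Set.encard_le_encard_of_injOn (f := f.extend)
    (fun y hy => (f.extend_rel_iff hx (hmem y hy)).1 hy) fun y hy z hz hyz => ?_
  rw [Embedding.extend, Embedding.extend, dif_pos (hmem y hy), dif_pos (hmem z hz)] at hyz
  exact congrArg Subtype.val (f.injective (Subtype.ext hyz))

theorem Embedding.rep_extend_inj (f : Embedding A B) {x y : ℕ} (hx : A.IsLeastRep x)
    (hy : A.IsLeastRep y) (h : B.rep (f.extend x) = B.rep (f.extend y)) : x = y :=
  hx.eq_of_rel hy ((f.extend_rel_iff hx.1 hy.1).2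
    ((rep_eq_rep_iff (f.extend_mem hx.1) (f.extend_mem hy.1)).1 h))

theorem encard_eqClass_rep {x : ℕ} (hx : x ∈ A.univ) :
    (A.eqClass (A.rep x)).encard = (A.eqClass x).encard :=
  congrArg _ ((eqClass_eq_iff hx).2 (rel_rep hx)).symm

theorem Embedding.finite_infiniteClasses (f : Embedding A B) (hB : B.infiniteClasses.Finite) :
    A.infiniteClasses.Finite := by
  refine Set.Finite.of_injOn (f := fun c => B.eqClass (f.extend (sInf c))) ?_ ?_ hB
  · rintro c ⟨⟨a, ha, rfl⟩, hinf⟩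
    have hr : A.rep a ∈ A.univ := (isLeastRep_rep ha).1
    refine ⟨⟨_, f.extend_mem hr, rfl⟩, ?_⟩
    have h := f.encard_eqClass_le hr
    rw [encard_eqClass_rep ha, hinf.encard_eq, top_le_iff, Set.encard_eq_top_iff] at h
    exact h
  · rintro _ ⟨⟨a, ha, rfl⟩, -⟩ _ ⟨⟨b, hb, rfl⟩, -⟩ h
    have h1 := (eqClass_eq_iff (f.extend_mem (isLeastRep_rep ha).1)).1 h
    have h2 := (f.extend_rel_iff (isLeastRep_rep ha).1 (isLeastRep_rep hb).1).2 h1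
    rw [eqClass_eq_iff ha]
    exact A.trans _ _ _ (rel_rep ha) (A.trans _ _ _ h2 (A.symm _ _ (rel_rep hb)))

theorem finite_isLeastRep_infinite (hB : B.infiniteClasses.Finite) :
    {b | B.IsLeastRep b ∧ (B.eqClass b).Infinite}.Finite := by
  refine Set.Finite.of_injOn (f := B.eqClass) ?_ ?_ hB
  · exact fun b hb => ⟨⟨b, hb.1.1, rfl⟩, hb.2⟩
  intro b hb c hc h
  exact hb.1.eq_of_rel hc.1 ((eqClass_eq_iff hb.1.1).1 h)

/-- If `A` embeds into `B`, then all but finitely many classes of `A` are at most as large as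
infinitely many classes of `B`. -/
theorem Embedding.finite_large (f : Embedding A B) : {x | A.IsLeastRep x ∧
    {b | B.IsLeastRep b ∧ (A.eqClass x).encard ≤ (B.eqClass b).encard}.Finite}.Finite := by
  set S := {x | A.IsLeastRep x ∧
    {b | B.IsLeastRep b ∧ (A.eqClass x).encard ≤ (B.eqClass b).encard}.Finite}
  rcases S.eq_empty_or_nonempty with hS | hS
  · rw [hS]
    exact Set.finite_empty
  · obtain ⟨x₀, hx₀, hmin⟩ := WellFounded.has_min
      (InvImage.wf (fun x => (A.eqClass x).encard) wellFounded_lt) S hS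
    refine Set.Finite.of_injOn (f := fun x => B.rep (f.extend x)) (fun x hx => ?_)
      (fun x hx y hy h => f.rep_extend_inj hx.1 hy.1 h) hx₀.2
    refine ⟨isLeastRep_rep (f.extend_mem hx.1.1), ?_⟩
    rw [encard_eqClass_rep (f.extend_mem hx.1.1)]
    refine le_trans ?_ (f.encard_eqClass_le hx.1.1)
    exact not_lt.1 (hmin x hx)

theorem exists_computableFrom_zeroJump (hA : A.IsComputable) (hB : B.IsComputable)
    (hfin : B.infiniteClasses.Finite) (g : Embedding A B) :
    ∃ f : Embedding A B, f.ComputableFrom zeroJump := by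
  obtain ⟨N, hN⟩ : ∃ N, ∀ x, N ≤ x → A.IsLeastRep x → (A.eqClass x).Finite ∧
      {b | B.IsLeastRep b ∧ (A.eqClass x).encard ≤ (B.eqClass b).encard}.Infinite := by
    obtain ⟨m, hm⟩ := g.finite_large.bddAbove
    refine ⟨m + 1, fun x hx hxr => ?_⟩
    have hinf : {b | B.IsLeastRep b ∧ (A.eqClass x).encard ≤ (B.eqClass b).encard}.Infinite :=
      fun h => absurd (hm ⟨hxr, h⟩) (by omega)
    refine ⟨?_, hinf⟩
    by_contra hxinf
    -- An infinite class fits only into infinite classes, of which `B` has finitely many.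
    refine hinf ((finite_isLeastRep_infinite hfin).subset fun b hb => ⟨hb.1, ?_⟩)
    have h := hb.2
    rwa [Set.Infinite.encard_eq hxinf, top_le_iff, Set.encard_eq_top_iff] at h
  -- Greedy values exceed `M`, hence avoid every image in the table. The table is finite
  -- information, so `g` need not be computable.
  let M := (Finset.range N).sup fun x => B.rep (g.extend x)
  let table := (List.range N).map fun x => B.rep (g.extend x)
  let h : ℕ → ℕ := fun x => (table[x]?).getD (greedyLimit A B M N (x + 1))
  have hlow : ∀ x, x < N → h x = B.rep (g.extend x) := fun x hx => by simp [h, table, hx]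
  have hhigh : ∀ x, N ≤ x → h x = greedyLimit A B M N (x + 1) := fun x hx => by
    simp [h, table, hx]
  have hmono := monotone_greedyLimit (M := M) fun x hx hxr => (hN x hx hxr).2
  have hM : ∀ x, M ≤ greedyLimit A B M N x := fun x => hmono (Nat.zero_le x)
  have hspec := fun x (hx : N ≤ x) (hxr : A.IsLeastRep x) =>
    greedyLimit_succ (M := M) hx hxr (hN x hx hxr).2
  have hlt : ∀ x y, x < y → A.IsLeastRep x → A.IsLeastRep y → h x ≠ h y := by
    intro x y hxy hx hy
    rcases lt_or_ge y N with hyN | hyN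
    · rw [hlow x (hxy.trans hyN), hlow y hyN]
      exact fun he => hxy.ne (g.rep_extend_inj hx hy he)
    · rw [hhigh y hyN]
      refine ne_of_lt (lt_of_le_of_lt ?_ (hspec y hyN hy).1.1)
      rcases lt_or_ge x N with hxN | hxN
      · rw [hlow x hxN]
        exact (Finset.le_sup (f := fun x => B.rep (g.extend x)) (Finset.mem_range.2 hxN)).trans
          (hM y)
      · rw [hhigh x hxN]
        exact hmono hxy
  refine exists_computableFrom_of_limit hA hB
    (H := fun x t => (table[x]?).getD (greedyStage A B M N t (x + 1))) (h := h) ?_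
    (fun x => ?_) (fun x hx => ?_) (fun x hx => ?_) fun x y hx hy he => ?_
  · exact Computable.option_getD (Computable.list_getElem?.comp (Computable.const table)
      Computable.fst) ((computable_greedyStage hA hB M N).comp
        (Computable.succ.comp Computable.fst) Computable.snd)
  · filter_upwards [eventually_greedyStage_eq (M := M) hN (x + 1)] with t ht
    rw [ht]
  · rcases lt_or_ge x N with hxN | hxN
    · rw [hlow x hxN]
      exact isLeastRep_rep (g.extend_mem hx.1)
    · rw [hhigh x hxN]
      exact (hspec x hxN hx).1.2
  · rcases lt_or_ge x N with hxN | hxN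
    · rw [hlow x hxN, encard_eqClass_rep (g.extend_mem hx.1)]
      exact g.encard_eqClass_le hx.1
    · rw [hhigh x hxN]
      exact (hspec x hxN hx).2
  · rcases lt_trichotomy x y with hxy | hxy | hxy
    · exact absurd he (hlt x y hxy hx hy)
    · exact hxy
    · exact absurd he.symm (hlt y x hxy hy hx)

end EquivStructure

end

/-! ### The main theorem. -/

theorem mainTheorem5 :
    (∀ A : EquivStructure, A.IsComputable →
      (A.Delta02BiEmbCategorical ↔ A.infiniteClasses.Finite)) ∧
    ∃ B : EquivStructure, B.IsComputable ∧ B.infiniteClasses.Infinite ∧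
      (∀ T : Set ℕ, B.IsTransversalOf B.infPart T → ImmuneIn zeroJump T) ∧
      ∀ A : EquivStructure, A.IsComputable → A.infiniteClasses.Infinite →
        A.finiteClasses = ∅ →
          A.BiEmbeddable B ∧ ¬ ∃ f : A.Embedding B, f.ComputableFrom zeroJump := by
  open EquivStructure in
  obtain ⟨B, hB, hBinf, hT, hW⟩ := exists_forall_sigmaTwo_finite
  refine ⟨fun A hA => ⟨fun hcat => ?_, fun hfin => ⟨hA, fun C hC hAC => ?_⟩⟩, B, hB, hBinf,
    fun T hTB => ⟨hT T hTB, fun W hWT hWinf hce => ?_⟩, fun A hA hAinf hAfin => ⟨⟨?_, ?_⟩, ?_⟩⟩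
  · by_contra hinf
    -- The detour through `omegaOmega` is needed because `A` itself may have finite classes.
    obtain ⟨-, f, hf⟩ := hcat.2 omegaOmega isComputable_omegaOmega
      ⟨nonempty_embedding_of_infinite infiniteClasses_omegaOmega,
        nonempty_embedding_of_infinite hinf⟩
    obtain ⟨⟨g, hg⟩, -⟩ := hcat.2 B hB
      ⟨nonempty_embedding_of_infinite hBinf, nonempty_embedding_of_infinite hinf⟩
    exact not_computableFrom_zeroJump isComputable_omegaOmega infiniteClasses_omegaOmega
      finiteClasses_omegaOmega hW (f.trans g) (hf.trans hg)
  · obtain ⟨⟨f⟩, ⟨g⟩⟩ := hAC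
    exact ⟨exists_computableFrom_zeroJump hA hC (g.finite_infiniteClasses hfin) f,
      exists_computableFrom_zeroJump hC hA hfin g⟩
  · exact hWinf (hW W (hWT.trans hTB.1) (fun x hx y hy => hTB.2.1 x (hWT hx) y (hWT hy))
      hce.sigmaTwo)
  · exact nonempty_embedding_of_infinite hBinf
  · exact nonempty_embedding_of_infinite hAinf
  · rintro ⟨f, hf⟩
    exact not_computableFrom_zeroJump hA hAinf hAfin hW f hf
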